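/- For a finite group $G$ let $d(G)$ be the smallest $d$ such that some subset $S\subseteq G$ with $d$ elements has normal closure equal to $G$. The class of semiabelian groups is the smallest class of finite groups that contains all finite abelian groups, contains every semidirect product $A\rtimes G$ with $A$ finite abelian and $G$ in the class, and is closed under homomorphic images. For groups $H, G$ let $H\wr G=H^{G}\rtimes G$ be the standard (regular) wreath product. For a finite semiabelian group $G$, the wreath length $\mathrm{wl}(G)$ is the smallest positive integer $r$ for which there are finite cyclic groups $C_1,\dots,C_r$ and an epimorphism $C_1\wr(C_2\wr(\cdots\wr C_r))\to G$. **Proposition.** Let $G$ be a nontrivial finite nilpotent semiabelian group. Then $\mathrm{wl}(G)=d(G)$. In particular, with $d=d(G)$, there are finite cyclic groups $C_1,\dots,C_d$ and an epimorphism $C_1\wr(C_2\wr(\cdots\wr C_d))\to G$. -/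

import Mathlib

universe u

/-- The family of (finite) semiabelian groups: the smallest family of finite groups that contains
the finite abelian groups and is closed under semidirect products `A ⋊ G` with `A` finite abelian
and `G` in the family, and under homomorphic images. -/
inductive IsSemiabelian : (G : Type u) → [Group G] → Prop
  | abelian (A : Type u) [CommGroup A] [Finite A] : IsSemiabelian A
  | semidirect (A G : Type u) [CommGroup A] [Finite A] [Group G] (φ : G →* MulAut A) :
      IsSemiabelian G → IsSemiabelian (A ⋊[φ] G)
  | image (G H : Type u) [Group G] [Group H] (f : G →* H) (hf : Function.Surjective f) :
      IsSemiabelian G → IsSemiabelian H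

/-- `normalGenRank G` is `d(G)`: the smallest `d` such that some `d`-element subset `S` of `G`
has normal closure `G`. (For finite `G` such a `d` exists.) -/
noncomputable def normalGenRank (G : Type u) [Group G] : ℕ :=
  sInf {d : ℕ | ∃ S : Finset G, S.card = d ∧ Subgroup.normalClosure (S : Set G) = ⊤}

/-- The descending iterated standard wreath product `C₁ ≀ (C₂ ≀ (⋯ ≀ C_r))` of a family of `r`
groups (indexed from `0`). It is `C₁` for `r = 1`, and the trivial group for `r = 0`. -/
def DescendingWreath : (r : ℕ) → (Fin r → Type u) → Type u
  | 0, _ => PUnit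
  | 1, C => C 0
  | r + 2, C => C 0 ≀ᵣ DescendingWreath (r + 1) (fun i => C i.succ)

/-- The group structure of the descending iterated standard wreath product. -/
@[reducible] def DescendingWreath.group :
    (r : ℕ) → (C : Fin r → Type u) → (∀ i, Group (C i)) → Group (DescendingWreath r C)
  | 0, _, _ => inferInstanceAs (Group PUnit)
  | 1, _, inst => inst 0
  | r + 2, C, inst =>
    @RegularWreathProduct.instGroup (C 0) (DescendingWreath (r + 1) (fun i => C i.succ)) (inst 0)
      (DescendingWreath.group (r + 1) (fun i => C i.succ) (fun i => inst i.succ))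

instance DescendingWreath.instGroup (r : ℕ) (C : Fin r → Type u) [inst : ∀ i, Group (C i)] : Group (DescendingWreath r C) :=
  DescendingWreath.group r C inst

/-- There are finite cyclic groups `C₁, …, C_r` and an epimorphism `C₁ ≀ (C₂ ≀ ⋯ ≀ C_r) → G`. -/
def IsCyclicWreathImage (G : Type u) [Group G] (r : ℕ) : Prop :=
  ∃ (C : Fin r → Type) (_ : ∀ i, Group (C i)),
    (∀ i, Finite (C i)) ∧ (∀ i, IsCyclic (C i)) ∧
      ∃ f : DescendingWreath r C →* G, Function.Surjective f

/-- The wreath length `wl(G)`: the smallest positive integer `r` such that there are finite cyclic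
groups `C₁, …, C_r` and an epimorphism `C₁ ≀ (C₂ ≀ ⋯ ≀ C_r) → G`. -/
noncomputable def wreathLength (G : Type u) [Group G] : ℕ :=
  sInf {r : ℕ | 0 < r ∧ IsCyclicWreathImage G r}

/-!
An epimorphism from `C₁ ≀ (C₂ ≀ (⋯ ≀ C_r))` onto `G`, with the `C_i` cyclic, amounts to a generating
sequence `c₁, …, c_r` of `G` such that, for every `i`, the conjugates of `c_i` under
`⟨c_{i+1}, …, c_r⟩` commute with one another; such sequences are called wreath towers
(`IsWreathTower`). One direction, `IsWreathTower.isCyclicWreathImage`, comes from iterating the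
mapping property of the wreath product. Unfolding the definition of a semiabelian group shows that
every such group has a generating wreath tower (`IsSemiabelian.exists_isWreathTower`).

The defining condition of a wreath tower passes to subsequences. In a finite `p`-group any
generating family contains a generating subfamily whose size is the dimension of the Frattini
quotient, and this dimension is at most the size of any normally generating set, because the
Frattini quotient is abelian (`IsPGroup.exists_finset_closure_eq_top`). Hence a semiabelian
`p`-group `P` has a generating wreath tower of length `d(P)`. A finite nilpotent group `G` is the
product of its Sylow subgroups `P`, each of which is a quotient of `G` and so has `d(P) ≤ d(G)`; after
padding with trivial elements, the towers of the `P` combine coordinatewise into a tower of length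
`d(G)`, which generates because the orders are coprime
(`IsSemiabelian.exists_isWreathTower_normalGenRank`).

Conversely, the iterated wreath product of `r` cyclic groups is the normal closure of `r` elements,
one generator for each factor (`DescendingWreath.exists_normalClosure_eq_top`), so `d(G) ≤ r` for all
its quotients `G`.
-/

open Subgroup

/-! ### Wreath towers -/

/-- A finite sequence `c` of elements of a group is a *wreath tower* if, for each `i`, the conjugates
of `c i` under the subgroup generated by the later terms commute with one another. In a finite
group `G`, the sequences of length `r` with this property that generate `G` correspond to epimorphisms onto `G` from
`C₁ ≀ (C₂ ≀ (⋯ ≀ C_r))` with cyclic `C_i`, where `c i` is the image of a generator of `C_i`. -/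
def IsWreathTower {G : Type*} [Group G] {r : ℕ} (c : Fin r → G) : Prop :=
  ∀ i, ∀ h ∈ closure (c '' Set.Ioi i), ∀ k ∈ closure (c '' Set.Ioi i),
    Commute (h * c i * h⁻¹) (k * c i * k⁻¹)

namespace IsWreathTower

variable {G H : Type*} [Group G] [Group H] {r : ℕ} {c : Fin r → G}

lemma map (hc : IsWreathTower c) (f : G →* H) : IsWreathTower (f ∘ c) := by
  intro i h hh k hk
  rw [Set.image_comp, ← MonoidHom.map_closure] at hh hk
  obtain ⟨h, hh, rfl⟩ := hh
  obtain ⟨k, hk, rfl⟩ := hk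
  simpa using (hc i h hh k hk).map f

lemma comp_strictMono (hc : IsWreathTower c) {s : ℕ} {e : Fin s → Fin r} (he : StrictMono e) :
    IsWreathTower (c ∘ e) := by
  intro i h hh k hk
  have hle : closure ((c ∘ e) '' Set.Ioi i) ≤ closure (c '' Set.Ioi (e i)) := by
    refine closure_mono ?_
    rintro _ ⟨j, hj, rfl⟩
    exact ⟨e j, he hj, rfl⟩
  exact hc (e i) h (hle hh) k (hle hk)

lemma cons (hc : IsWreathTower c) {a : G}
    (ha : ∀ h k : G, Commute (h * a * h⁻¹) (k * a * k⁻¹)) :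
    IsWreathTower (Fin.cons a c : Fin (r + 1) → G) := by
  intro i
  refine Fin.cases (fun h _ k _ ↦ by simpa using ha h k) (fun i ↦ ?_) i
  have hs : (Fin.cons a c : Fin (r + 1) → G) '' Set.Ioi i.succ = c '' Set.Ioi i := by
    ext x
    simp [Fin.exists_fin_succ]
  rw [hs]
  simpa using hc i

lemma tail {c : Fin (r + 1) → G} (hc : IsWreathTower c) : IsWreathTower (c ∘ Fin.succ) :=
  hc.comp_strictMono (Fin.strictMono_succ)

end IsWreathTower

/-- A tower generating `G` can be lengthened by putting copies of `1` in front. -/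
lemma exists_isWreathTower_of_le {G : Type*} [Group G] {r s : ℕ} (hrs : r ≤ s) {c : Fin r → G}
    (hc : IsWreathTower c) (hgen : closure (Set.range c) = ⊤) :
    ∃ c' : Fin s → G, IsWreathTower c' ∧ closure (Set.range c') = ⊤ := by
  induction s, hrs using Nat.le_induction with
  | base => exact ⟨c, hc, hgen⟩
  | succ s _ ih =>
    obtain ⟨c', hc', hgen'⟩ := ih
    refine ⟨Fin.cons 1 c', hc'.cons (by simp), ?_⟩
    rw [Fin.range_cons, closure_insert_one, hgen']

/-- A finite set of elements with commuting conjugates can be prepended to a tower. -/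
lemma exists_isWreathTower_union {G : Type*} [Group G] {r : ℕ} {c : Fin r → G}
    (hc : IsWreathTower c) {s : Set G} (hs : s.Finite)
    (hcomm : ∀ a ∈ s, ∀ h k : G, Commute (h * a * h⁻¹) (k * a * k⁻¹)) :
    ∃ (r' : ℕ) (c' : Fin r' → G), IsWreathTower c' ∧ Set.range c' = s ∪ Set.range c := by
  induction s, hs using Set.Finite.induction_on with
  | empty => exact ⟨r, c, hc, by simp⟩
  | @insert a s _ _ ih =>
    obtain ⟨r', c', hc', hrange⟩ := ih fun b hb ↦ hcomm b (Set.mem_insert_of_mem _ hb)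
    refine ⟨r' + 1, Fin.cons a c', hc'.cons (hcomm a (Set.mem_insert _ _)), ?_⟩
    rw [Fin.range_cons, hrange, Set.insert_union]

/-- The factor `A` of a semidirect product `A ⋊ G` contributes all of its elements, placed in front
of a tower of `G`; a homomorphic image of a tower is a tower. -/
theorem IsSemiabelian.exists_isWreathTower {G : Type u} [Group G] (hG : IsSemiabelian G) :
    ∃ (r : ℕ) (c : Fin r → G), IsWreathTower c ∧ closure (Set.range c) = ⊤ := by
  induction hG with
  | abelian A =>
    obtain ⟨r, c, hc, hrange⟩ := exists_isWreathTower_union (c := (Fin.elim0 : Fin 0 → A))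
      (fun i ↦ i.elim0) (Set.toFinite Set.univ) (fun a _ h k ↦ Commute.all _ _)
    exact ⟨r, c, hc, by simp [hrange]⟩
  | semidirect A G φ _ ih =>
    obtain ⟨r, c, hc, hgen⟩ := ih
    obtain ⟨r', c', hc', hrange⟩ := exists_isWreathTower_union
      (hc.map (SemidirectProduct.inr : G →* A ⋊[φ] G))
      (s := Set.range (SemidirectProduct.inl : A →* A ⋊[φ] G)) (Set.finite_range _) (by
        -- conjugates of elements of `A` stay in the commutative normal subgroup `A`
        rintro _ ⟨a, rfl⟩ h k
        have key : ∀ g : A ⋊[φ] G, ∃ b : A, g * SemidirectProduct.inl a * g⁻¹ =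
            SemidirectProduct.inl b := by
          intro g
          have : g * SemidirectProduct.inl a * g⁻¹ ∈
              (SemidirectProduct.rightHom : A ⋊[φ] G →* G).ker := by simp [MonoidHom.mem_ker]
          rw [← SemidirectProduct.range_inl_eq_ker_rightHom] at this
          obtain ⟨b, hb⟩ := this
          exact ⟨b, hb.symm⟩
        obtain ⟨x, hx⟩ := key h
        obtain ⟨y, hy⟩ := key k
        rw [hx, hy]
        exact (Commute.all x y).map _)
    refine ⟨r', c', hc', ?_⟩
    rw [hrange, Subgroup.closure_union, Set.range_comp, ← MonoidHom.map_closure, hgen,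
      ← MonoidHom.coe_range, closure_eq, eq_top_iff]
    intro x _
    rw [← SemidirectProduct.inl_left_mul_inr_right x]
    exact mul_mem (mem_sup_left ⟨_, rfl⟩) (mem_sup_right ⟨_, trivial, rfl⟩)
  | image G H f hf _ ih =>
    obtain ⟨r, c, hc, hgen⟩ := ih
    refine ⟨r, f ∘ c, hc.map f, ?_⟩
    rw [Set.range_comp, ← MonoidHom.map_closure, hgen, map_top_of_surjective f hf]

/-! ### The Frattini quotient of a finite `p`-group -/

section PGroup

variable {P : Type u} [Group P] [Finite P] {p : ℕ} [Fact p.Prime]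

/-- A maximal normal subgroup of a finite `p`-group has index `p`: an element of order `p` in the
quotient generates it, by maximality. -/
lemma IsPGroup.card_quotient_coatom (hP : IsPGroup p P) {M : Subgroup P} [M.Normal]
    (hM : IsCoatom M) : Nat.card (P ⧸ M) = p := by
  have hdvd : p ∣ Nat.card (P ⧸ M) := by
    have : Nontrivial (P ⧸ M) := QuotientGroup.nontrivial_iff.2 hM.1
    obtain ⟨n, hn, h⟩ := (hP.to_quotient M).nontrivial_iff_card.1 this
    exact h ▸ dvd_pow_self p hn.ne'
  obtain ⟨x, hx⟩ := exists_prime_orderOf_dvd_card' p hdvd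
  -- the preimage of `⟨x⟩` strictly contains the maximal subgroup `M`
  have htop : zpowers x = ⊤ := by
    have hlt : M < (zpowers x).comap (QuotientGroup.mk' M) := by
      refine lt_of_le_of_ne ?_ ?_
      · exact (QuotientGroup.ker_mk' M).symm.le.trans
          (MonoidHom.ker_le_comap (QuotientGroup.mk' M) (zpowers x))
      · intro h
        obtain ⟨g, rfl⟩ := QuotientGroup.mk'_surjective M x
        have hg : g ∈ M := by
          rw [h]
          exact mem_zpowers _
        have h1 : QuotientGroup.mk' M g = 1 := (QuotientGroup.eq_one_iff g).2 hg
        rw [h1, orderOf_one] at hx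
        exact (Fact.out : p.Prime).one_lt.ne hx
    have := hM.2 _ hlt
    rw [← map_comap_eq_self_of_surjective (QuotientGroup.mk'_surjective M) (zpowers x), this,
      map_top_of_surjective _ (QuotientGroup.mk'_surjective M)]
  rw [← hx, ← Nat.card_zpowers, htop, card_top]

lemma mem_frattini {G : Type*} [Group G] {x : G} :
    x ∈ frattini G ↔ ∀ M : Subgroup G, IsCoatom M → x ∈ M := by
  simp [frattini, Order.radical, mem_iInf]

/-- The vector space `V` over `ZMod p` is the quotient of `P` by its Frattini subgroup; it detects
whether a subgroup is all of `P`. -/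
lemma IsPGroup.exists_frattini_quotient (hP : IsPGroup p P) :
    ∃ (V : Type u) (_ : AddCommGroup V) (_ : Module (ZMod p) V) (_ : Finite V)
      (q : P →* Multiplicative V),
        Function.Surjective q ∧ ∀ K : Subgroup P, K.map q = ⊤ → K = ⊤ := by
  have hnil : Group.IsNilpotent P := hP.isNilpotent
  have hnormal : ∀ M : Subgroup P, IsCoatom M → M.Normal := fun M hM ↦
    NormalizerCondition.normal_of_coatom M Group.normalizerCondition_of_isNilpotent hM
  have hcomm : ∀ a b : P, (a * b)⁻¹ * (b * a) ∈ frattini P := fun a b ↦ by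
    refine mem_frattini.2 fun M hM ↦ ?_
    have := hnormal M hM
    have := isCyclic_of_prime_card (hP.card_quotient_coatom hM)
    rw [← QuotientGroup.eq]
    exact IsCyclic.isMulCommutative.is_comm.comm (a : P ⧸ M) b
  have hpow : ∀ a : P, a ^ p ∈ frattini P := fun a ↦ by
    refine mem_frattini.2 fun M hM ↦ ?_
    have := hnormal M hM
    rw [← QuotientGroup.eq_one_iff, QuotientGroup.mk_pow, ← hP.card_quotient_coatom hM,
      pow_card_eq_one']
  have hfrattini : ∀ K : Subgroup P, K.map (QuotientGroup.mk' (frattini P)) = ⊤ → K = ⊤ := by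
    intro K hK
    refine frattini_nongenerating ?_
    have := congrArg (comap (QuotientGroup.mk' (frattini P))) hK
    rwa [comap_map_eq, QuotientGroup.ker_mk', comap_top] at this
  let _ : CommGroup (P ⧸ frattini P) :=
    { (inferInstance : Group (P ⧸ frattini P)) with
      mul_comm := by
        intro x y
        induction x using QuotientGroup.induction_on
        induction y using QuotientGroup.induction_on
        exact QuotientGroup.eq.2 (hcomm _ _) }
  let _ : Module (ZMod p) (Additive (P ⧸ frattini P)) := AddCommGroup.zmodModule (n := p) (by
    intro x
    induction x using QuotientGroup.induction_on with
    | H a => exact (QuotientGroup.eq_one_iff (a ^ p)).2 (hpow a))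
  refine ⟨Additive (P ⧸ frattini P), inferInstance, inferInstance, inferInstance,
    QuotientGroup.mk' (frattini P), QuotientGroup.mk'_surjective _, hfrattini⟩

/-- A form of the Burnside basis theorem: a generating family of a finite `p`-group contains a
generating subfamily no larger than any given normally generating set. -/
lemma IsPGroup.exists_finset_closure_eq_top (hP : IsPGroup p P) {ι : Type*} [Finite ι] (c : ι → P)
    (hgen : closure (Set.range c) = ⊤) (S : Finset P) (hS : normalClosure (S : Set P) = ⊤) :
    ∃ s : Finset ι, s.card ≤ S.card ∧ closure (c '' s) = ⊤ := by
  classical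
  obtain ⟨V, _, _, _, q, hqs, hq⟩ := hP.exists_frattini_quotient
  let v : P → V := fun x ↦ (q x).toAdd
  -- conjugate elements have the same image in `V`, so normal generation suffices for spanning
  have hspan : ∀ X : Set P, normalClosure X = ⊤ → Submodule.span (ZMod p) (v '' X) = ⊤ := by
    intro X hX
    let N : Subgroup (Multiplicative V) :=
      AddSubgroup.toSubgroup (Submodule.span (ZMod p) (v '' X)).toAddSubgroup
    have hN : (⊤ : Subgroup P) ≤ N.comap q := hX ▸ normalClosure_le_normal fun x hx ↦
      Submodule.subset_span (Set.mem_image_of_mem v hx)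
    refine eq_top_iff.2 fun y _ ↦ ?_
    obtain ⟨x, hx⟩ := hqs (Multiplicative.ofAdd y)
    have : q x ∈ N := hN (mem_top x)
    rw [hx] at this
    exact this
  have hdim : Module.finrank (ZMod p) V ≤ S.card := by
    have h := finrank_span_finset_le_card (R := ZMod p) (S.image v)
    rw [Set.finrank, Finset.coe_image, hspan _ hS, finrank_top] at h
    exact h.trans Finset.card_image_le
  obtain ⟨κ, a, ha, hspan', hind⟩ := exists_linearIndependent' (ZMod p) (v ∘ c)
  have : Finite κ := Finite.of_injective a ha
  have := Fintype.ofFinite κ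
  refine ⟨Finset.univ.image a, ?_, hq _ ?_⟩
  · exact Finset.card_image_le.trans (hind.fintype_card_le_finrank.trans hdim)
  · rw [Set.range_comp v c, hspan _ (top_le_iff.1 (hgen ▸ closure_le_normalClosure))] at hspan'
    set K := (closure (c '' (Finset.univ.image a : Finset ι))).map q
    let T : Submodule (ZMod p) V := AddSubgroup.toZModSubmodule p (Subgroup.toAddSubgroup' K)
    have hT : (⊤ : Submodule (ZMod p) V) ≤ T := by
      rw [← hspan', Submodule.span_le]
      rintro _ ⟨k, rfl⟩
      exact mem_map_of_mem q (subset_closure ⟨a k, by simp, rfl⟩)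
    exact eq_top_iff.2 fun y _ ↦ hT (Submodule.mem_top (x := Multiplicative.toAdd y))

end PGroup

/-! ### Normal rank -/

lemma exists_finset_card_eq_normalGenRank (G : Type u) [Group G] [Finite G] :
    ∃ S : Finset G, S.card = normalGenRank G ∧ normalClosure (S : Set G) = ⊤ := by
  have := Fintype.ofFinite G
  refine Nat.sInf_mem (s := {d : ℕ | ∃ S : Finset G, S.card = d ∧ normalClosure (S : Set G) = ⊤})
    ⟨_, Finset.univ, rfl, ?_⟩
  exact eq_top_iff.2 fun x _ ↦ subset_normalClosure (by simp)

lemma normalGenRank_le {G : Type u} [Group G] (S : Finset G)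
    (hS : normalClosure (S : Set G) = ⊤) : normalGenRank G ≤ S.card :=
  Nat.sInf_le ⟨S, rfl, hS⟩

lemma normalGenRank_pos (G : Type u) [Group G] [Finite G] [Nontrivial G] :
    0 < normalGenRank G := by
  obtain ⟨S, hcard, hS⟩ := exists_finset_card_eq_normalGenRank G
  rw [Nat.pos_iff_ne_zero, ← hcard]
  intro h
  rw [Finset.card_eq_zero.1 h, Finset.coe_empty, normalClosure_empty] at hS
  exact bot_ne_top hS

lemma normalGenRank_le_of_surjective {G : Type*} {H : Type u} [Group G] [Group H] (f : G →* H)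
    (hf : Function.Surjective f) {r : ℕ} (S : Finset G) (hr : S.card ≤ r)
    (hS : normalClosure (S : Set G) = ⊤) : normalGenRank H ≤ r := by
  classical
  refine (normalGenRank_le (S.image f) ?_).trans (Finset.card_image_le.trans hr)
  rw [Finset.coe_image, ← map_normalClosure _ f hf, hS, map_top_of_surjective f hf]

/-! ### Short towers in nilpotent groups -/

/-- A subfamily of a tower is a tower, so a tower generating a `p`-group can be thinned out to a
minimal generating family, and then padded to length `d`. -/
lemma IsSemiabelian.exists_isWreathTower_of_isPGroup {P : Type u} [Group P] [Finite P] {p : ℕ}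
    [Fact p.Prime] (hP : IsPGroup p P) (hs : IsSemiabelian P) {d : ℕ} (hd : normalGenRank P ≤ d) :
    ∃ c : Fin d → P, IsWreathTower c ∧ closure (Set.range c) = ⊤ := by
  obtain ⟨r, c, hc, hgen⟩ := hs.exists_isWreathTower
  obtain ⟨S, hcard, hS⟩ := exists_finset_card_eq_normalGenRank P
  obtain ⟨s, hsS, hgen'⟩ := hP.exists_finset_closure_eq_top c hgen S hS
  refine exists_isWreathTower_of_le (hsS.trans (hcard.trans_le hd))
    -- list the chosen indices in increasing order
    (hc.comp_strictMono (s.orderEmbOfFin rfl).strictMono) ?_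
  rw [Set.range_comp, Finset.range_orderEmbOfFin, hgen']

/-- A subgroup of a product of groups of pairwise coprime orders that projects onto every factor has
order divisible by that of each factor, hence is everything. -/
lemma Subgroup.eq_top_of_map_eval_eq_top {ι : Type*} [Finite ι] {G : ι → Type*} [∀ i, Group (G i)]
    [∀ i, Finite (G i)]
    (hcop : Pairwise fun i j ↦ (Nat.card (G i)).Coprime (Nat.card (G j)))
    (K : Subgroup (∀ i, G i)) (hK : ∀ i, K.map (Pi.evalMonoidHom G i) = ⊤) : K = ⊤ := by
  have := Fintype.ofFinite ι
  refine eq_top_of_le_card K (Nat.le_of_dvd Nat.card_pos ?_)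
  rw [Nat.card_pi]
  refine Finset.prod_dvd_of_isRelPrime (fun i _ j _ hij ↦ ?_) fun i _ ↦ ?_
  · exact Nat.coprime_iff_isRelPrime.1 (hcop hij)
  · have h := K.card_map_dvd (Pi.evalMonoidHom G i)
    rwa [hK i, card_top] at h

/-- Towers of equal length in groups of coprime orders combine coordinatewise. -/
lemma exists_isWreathTower_pi {ι : Type*} [Finite ι] {G : ι → Type*} [∀ i, Group (G i)]
    [∀ i, Finite (G i)]
    (hcop : Pairwise fun i j ↦ (Nat.card (G i)).Coprime (Nat.card (G j))) {d : ℕ}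
    (h : ∀ i, ∃ c : Fin d → G i, IsWreathTower c ∧ closure (Set.range c) = ⊤) :
    ∃ c : Fin d → ∀ i, G i, IsWreathTower c ∧ closure (Set.range c) = ⊤ := by
  choose c hc hgen using h
  refine ⟨fun n i ↦ c i n, fun n x hx y hy ↦ ?_, ?_⟩
  · have key : ∀ i, ∀ z ∈ closure ((fun n i ↦ c i n) '' Set.Ioi n),
        z i ∈ closure (c i '' Set.Ioi n) := by
      intro i z hz
      have h := mem_map_of_mem (Pi.evalMonoidHom G i) hz
      rwa [MonoidHom.map_closure, ← Set.image_comp] at h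
    exact funext fun i ↦ hc i n (x i) (key i x hx) (y i) (key i y hy)
  · refine eq_top_of_map_eval_eq_top hcop _ fun i ↦ ?_
    rw [MonoidHom.map_closure, ← Set.range_comp]
    exact hgen i

theorem IsSemiabelian.exists_isWreathTower_normalGenRank {G : Type u} [Group G] [Finite G]
    [Group.IsNilpotent G] (hG : IsSemiabelian G) :
    ∃ c : Fin (normalGenRank G) → G, IsWreathTower c ∧ closure (Set.range c) = ⊤ := by
  obtain ⟨e⟩ := ((Group.isNilpotent_of_finite_tfae (G := G)).out 0 4).1 ‹_›
  -- nilpotency makes the Sylow `p`-subgroup unique, so the inner product has a single factor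
  have hpgroup : ∀ p : (Nat.card G).primeFactors,
      IsPGroup p (∀ Q : Sylow p G, (Q : Subgroup G)) := by
    intro p
    have : Fact (p : ℕ).Prime := ⟨Nat.prime_of_mem_primeFactors p.2⟩
    have : Unique (Sylow p G) := Sylow.unique_of_normal default inferInstance
    exact this.default.isPGroup'.of_equiv
      (MulEquiv.piUnique fun Q : Sylow p G ↦ (Q : Subgroup G)).symm
  obtain ⟨c, hc, hgen⟩ : ∃ c : Fin (normalGenRank G) →
      ∀ p : (Nat.card G).primeFactors, ∀ Q : Sylow p G, (Q : Subgroup G),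
      IsWreathTower c ∧ closure (Set.range c) = ⊤ := by
    refine exists_isWreathTower_pi (fun p q hpq ↦ ?_) fun p ↦ ?_
    · have : Fact (p : ℕ).Prime := ⟨Nat.prime_of_mem_primeFactors p.2⟩
      have : Fact (q : ℕ).Prime := ⟨Nat.prime_of_mem_primeFactors q.2⟩
      obtain ⟨m, hm⟩ := IsPGroup.iff_card.1 (hpgroup p)
      obtain ⟨n, hn⟩ := IsPGroup.iff_card.1 (hpgroup q)
      beta_reduce
      rw [hm, hn]
      exact Nat.coprime_pow_primes m n Fact.out Fact.out fun h ↦ hpq (Subtype.ext h)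
    · have : Fact (p : ℕ).Prime := ⟨Nat.prime_of_mem_primeFactors p.2⟩
      let f : G →* ∀ Q : Sylow p G, (Q : Subgroup G) :=
        (Pi.evalMonoidHom (fun p : (Nat.card G).primeFactors ↦
          ∀ Q : Sylow p G, (Q : Subgroup G)) p).comp e.symm.toMonoidHom
      have hf : Function.Surjective f := (Function.surjective_eval p).comp e.symm.surjective
      obtain ⟨S, hcard, hS⟩ := exists_finset_card_eq_normalGenRank G
      exact (IsSemiabelian.image _ _ f hf hG).exists_isWreathTower_of_isPGroup (hpgroup p)
        (normalGenRank_le_of_surjective f hf S hcard.le hS)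
  refine ⟨e ∘ c, hc.map e.toMonoidHom, ?_⟩
  have h := MonoidHom.map_closure e.toMonoidHom (Set.range c)
  rw [hgen, map_top_of_surjective _ e.surjective, ← Set.range_comp] at h
  exact h.symm

/-! ### Homomorphisms out of wreath products -/

namespace RegularWreathProduct

variable {D Q G : Type*} [Group D] [Group Q] [Group G]

/-- The copy of `D` in `D ≀ᵣ Q` consisting of the functions supported at `1 : Q`. -/
noncomputable def baseHom : D →* D ≀ᵣ Q := by
  classical
  exact
  { toFun := fun x ↦ ⟨Pi.mulSingle 1 x, 1⟩
    map_one' := by ext <;> simp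
    map_mul' := fun x y ↦ by ext <;> simp [Pi.mulSingle_mul] }

/-- Homomorphisms `φ : D →* G` and `g : Q →* G` extend to `D ≀ᵣ Q` as soon as the conjugates of
the image of `φ` by distinct elements of `Q` commute with each other. Of the extension, only its
range is recorded. -/
lemma exists_lift [Finite Q] (φ : D →* G) (g : Q →* G)
    (hcomm : ∀ q q' : Q, q ≠ q' → ∀ x y : D,
      Commute (g q * φ x * (g q)⁻¹) (g q' * φ y * (g q')⁻¹)) :
    ∃ f : D ≀ᵣ Q →* G, f.range = φ.range ⊔ g.range := by
  classical
  have := Fintype.ofFinite Q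
  let ψ : Q → D →* G := fun q ↦ (MulAut.conj (g q)).toMonoidHom.comp φ
  let Ψ : (Q → D) →* G := MonoidHom.noncommPiCoprod ψ fun q q' h x y ↦ hcomm q q' h x y
  have hΨ : ∀ q x, Ψ (Pi.mulSingle q x) = g q * φ x * (g q)⁻¹ := fun q x ↦
    MonoidHom.noncommPiCoprod_mulSingle _ _ _
  -- `Ψ` is equivariant: it suffices to compare both sides on functions supported at one point
  have hequiv : ∀ (q : Q) (b : Q → D), Ψ (fun x ↦ b (q⁻¹ * x)) = g q * Ψ b * (g q)⁻¹ := by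
    intro q b
    let shift : (Q → D) →* (Q → D) :=
      { toFun := fun b x ↦ b (q⁻¹ * x), map_one' := rfl, map_mul' := fun _ _ ↦ rfl }
    have h : Ψ.comp shift = (MulAut.conj (g q)).toMonoidHom.comp Ψ := by
      refine MonoidHom.pi_ext fun q' x ↦ ?_
      have hs : shift (Pi.mulSingle q' x) = Pi.mulSingle (q * q') x := by
        funext y
        simp [shift, Pi.mulSingle_apply, inv_mul_eq_iff_eq_mul]
      simp [hs, hΨ, mul_assoc]
    exact DFunLike.congr_fun h b
  let f : D ≀ᵣ Q →* G :=
    { toFun := fun w ↦ Ψ w.left * g w.right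
      map_one' := by simp
      map_mul' := fun w w' ↦ by simp [hequiv, mul_assoc] }
  refine ⟨f, le_antisymm ?_ (sup_le ?_ ?_)⟩
  · rintro _ ⟨w, rfl⟩
    refine mul_mem ?_ (mem_sup_right ⟨_, rfl⟩)
    have hrange : Ψ.range ≤ φ.range ⊔ g.range := by
      refine (MonoidHom.noncommPiCoprod_range ..).trans_le (iSup_le fun q ↦ ?_)
      rintro _ ⟨x, rfl⟩
      exact mul_mem (mul_mem (mem_sup_right ⟨q, rfl⟩) (mem_sup_left ⟨x, rfl⟩))
        (inv_mem (mem_sup_right ⟨q, rfl⟩))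
    exact hrange ⟨_, rfl⟩
  · rintro _ ⟨x, rfl⟩
    exact ⟨⟨Pi.mulSingle 1 x, 1⟩, by simp [f, hΨ]⟩
  · rintro _ ⟨q, rfl⟩
    exact ⟨inl q, by simp [f]⟩

/-- The base group `Q → D` is generated by the conjugates of the copy of `D` supported at `1`. -/
lemma normalClosure_eq_top [Finite Q] {N : Subgroup (D ≀ᵣ Q)} [N.Normal]
    (hD : (baseHom : D →* D ≀ᵣ Q).range ≤ N) (hQ : (inl : Q →* D ≀ᵣ Q).range ≤ N) : N = ⊤ := by
  classical
  let leftHom : (Q → D) →* D ≀ᵣ Q :=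
    { toFun := fun a ↦ ⟨a, 1⟩, map_one' := rfl
      map_mul' := fun a b ↦ by ext <;> simp }
  have hleft : (⊤ : Subgroup (Q → D)) ≤ N.comap leftHom := by
    rw [← pi_top Set.univ, pi_le_iff]
    rintro q _ ⟨x, _, rfl⟩
    have h : leftHom (Pi.mulSingle q x) = inl q * baseHom x * (inl q)⁻¹ := by
      ext y
      · simp [leftHom, baseHom, Pi.mulSingle_apply, inv_mul_eq_one, eq_comm]
      · simp [leftHom, baseHom]
    change leftHom (Pi.mulSingle q x) ∈ N
    rw [h]
    exact ‹N.Normal›.conj_mem _ (hD ⟨x, rfl⟩) (inl q)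
  refine eq_top_iff.2 fun w _ ↦ ?_
  have hw : w = leftHom w.left * inl w.right := by ext <;> simp [leftHom]
  rw [hw]
  exact mul_mem (hleft (mem_top w.left)) (hQ ⟨_, rfl⟩)

end RegularWreathProduct

/-! ### Iterated wreath products of cyclic groups -/

lemma DescendingWreath.finite : ∀ (r : ℕ) (C : Fin r → Type u) [∀ i, Group (C i)]
    [∀ i, Finite (C i)], Finite (DescendingWreath r C)
  | 0, _, _, _ => inferInstanceAs (Finite PUnit)
  | 1, C, _, _ => inferInstanceAs (Finite (C 0))
  | r + 2, C, _, _ =>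
    have := DescendingWreath.finite (r + 1) (fun i ↦ C i.succ)
    inferInstanceAs (Finite (C 0 ≀ᵣ DescendingWreath (r + 1) (fun i ↦ C i.succ)))

/-- A tower `c` is the image of the canonical generators of an iterated wreath product whose `i`-th
factor `C i` is mapped onto the cyclic group generated by `c i`. -/
lemma IsWreathTower.exists_hom {G : Type*} [Group G] : ∀ {r : ℕ} {c : Fin r → G}
    (_ : IsWreathTower c) (C : Fin r → Type u) [∀ i, Group (C i)] [∀ i, Finite (C i)]
    (φ : ∀ i, C i →* G) (_ : ∀ i, (φ i).range = zpowers (c i)),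
    ∃ f : DescendingWreath r C →* G, f.range = closure (Set.range c)
  | 0, c, _, C, _, _, φ, _ => by
    refine ⟨1, ?_⟩
    simp
  | 1, c, _, C, _, _, φ, hφ => by
    have h : (φ 0).range = closure (Set.range c) := by
      rw [hφ, Set.range_unique, zpowers_eq_closure]
      rfl
    exact ⟨φ 0, h⟩
  | r + 2, c, hc, C, _, _, φ, hφ => by
    obtain ⟨g, hg⟩ := hc.tail.exists_hom (fun i ↦ C i.succ) (fun i ↦ φ i.succ)
      (fun i ↦ hφ i.succ)
    have := DescendingWreath.finite (r + 1) (fun i ↦ C i.succ)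
    have hmem : ∀ q, g q ∈ closure (c '' Set.Ioi 0) := fun q ↦ by
      have h : g q ∈ g.range := ⟨q, rfl⟩
      rw [hg] at h
      refine closure_mono ?_ h
      rintro _ ⟨i, rfl⟩
      exact ⟨i.succ, Fin.succ_pos i, rfl⟩
    obtain ⟨f, hf⟩ := RegularWreathProduct.exists_lift (φ 0) g fun q q' _ x y ↦ by
      have hx : φ 0 x ∈ zpowers (c 0) := hφ 0 ▸ ⟨x, rfl⟩
      have hy : φ 0 y ∈ zpowers (c 0) := hφ 0 ▸ ⟨y, rfl⟩
      obtain ⟨m, hm⟩ := hx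
      obtain ⟨n, hn⟩ := hy
      have h := (hc 0 (g q) (hmem q) (g q') (hmem q')).zpow_zpow m n
      simpa only [conj_zpow, ← hm, ← hn] using h
    refine ⟨f, hf.trans ?_⟩
    rw [hg, hφ, zpowers_eq_closure, ← Subgroup.closure_union]
    congr 1
    ext x
    simp [Fin.exists_fin_succ, eq_comm]

theorem IsWreathTower.isCyclicWreathImage {G : Type u} [Group G] [Finite G] {r : ℕ} {c : Fin r → G}
    (hc : IsWreathTower c) (hgen : closure (Set.range c) = ⊤) : IsCyclicWreathImage G r := by
  have hfin : ∀ i, Finite (Multiplicative (ZMod (Nat.card (zpowers (c i))))) := fun i ↦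
    Finite.of_equiv _ (zmodCyclicMulEquiv (inferInstance : IsCyclic (zpowers (c i)))).symm.toEquiv
  obtain ⟨f, hf⟩ := hc.exists_hom (fun i ↦ Multiplicative (ZMod (Nat.card (zpowers (c i)))))
    (fun i ↦ (zpowers (c i)).subtype.comp
      (zmodCyclicMulEquiv (inferInstance : IsCyclic (zpowers (c i)))).toMonoidHom) (fun i ↦ by
      rw [MonoidHom.range_comp, MonoidHom.range_eq_top.2 (MulEquiv.surjective _),
        ← MonoidHom.range_eq_map, range_subtype])
  exact ⟨_, _, hfin, fun i ↦ inferInstance, f, MonoidHom.range_eq_top.1 (hf.trans hgen)⟩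

/-- One generator of each cyclic factor, taken at the coordinate `1` of its base group, is enough to
generate the iterated wreath product as a normal subgroup. -/
lemma DescendingWreath.exists_normalClosure_eq_top : ∀ (r : ℕ) (C : Fin r → Type u)
    [∀ i, Group (C i)] [∀ i, Finite (C i)] [∀ i, IsCyclic (C i)],
    ∃ S : Finset (DescendingWreath r C), S.card ≤ r ∧
      normalClosure (S : Set (DescendingWreath r C)) = ⊤
  | 0, C, _, _, _ => ⟨∅, le_rfl, eq_top_iff.2 fun _ _ ↦ one_mem _⟩
  | 1, C, _, _, _ => by
    obtain ⟨x, hx⟩ := IsCyclic.exists_generator (α := C 0)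
    have h : normalClosure (({x} : Finset (C 0)) : Set (C 0)) = ⊤ := by
      refine eq_top_iff.2 fun y _ ↦ ?_
      have hle : zpowers x ≤ normalClosure {x} := zpowers_le.2 (subset_normalClosure rfl)
      simpa using hle (hx y)
    exact ⟨({x} : Finset (C 0)), (Finset.card_singleton x).le, h⟩
  | r + 2, C, _, _, _ => by
    classical
    obtain ⟨S, hcard, hS⟩ := exists_normalClosure_eq_top (r + 1) (fun i ↦ C i.succ)
    obtain ⟨x, hx⟩ := IsCyclic.exists_generator (α := C 0)
    have := DescendingWreath.finite (r + 1) (fun i ↦ C i.succ)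
    let inr : DescendingWreath (r + 1) (fun i ↦ C i.succ) →*
      C 0 ≀ᵣ DescendingWreath (r + 1) (fun i ↦ C i.succ) := RegularWreathProduct.inl
    let S' : Finset (C 0 ≀ᵣ DescendingWreath (r + 1) (fun i ↦ C i.succ)) :=
      insert (RegularWreathProduct.baseHom x) (S.image inr)
    have hS' : normalClosure
        (S' : Set (C 0 ≀ᵣ DescendingWreath (r + 1) (fun i ↦ C i.succ))) = ⊤ := by
      refine RegularWreathProduct.normalClosure_eq_top ?_ ?_
      · rintro _ ⟨y, rfl⟩
        obtain ⟨n, rfl⟩ := hx y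
        simp only [map_zpow]
        exact zpow_mem (subset_normalClosure (by simp [S'])) n
      · rw [MonoidHom.range_eq_map, map_le_iff_le_comap, ← hS]
        exact normalClosure_le_normal fun s hs ↦ subset_normalClosure (by
          simp only [S', Finset.coe_insert, Finset.coe_image]
          exact Or.inr ⟨s, hs, rfl⟩)
    exact ⟨S', (Finset.card_insert_le _ _).trans
      (Nat.succ_le_succ (Finset.card_image_le.trans hcard)), hS'⟩

theorem IsCyclicWreathImage.normalGenRank_le {G : Type u} [Group G] {r : ℕ}
    (h : IsCyclicWreathImage G r) : normalGenRank G ≤ r := by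
  obtain ⟨C, _, hfin, hcyc, f, hf⟩ := h
  obtain ⟨S, hcard, hS⟩ := DescendingWreath.exists_normalClosure_eq_top r C
  exact normalGenRank_le_of_surjective f hf S hcard hS

theorem mainTheorem4 (G : Type u) [Group G] [Finite G] [Nontrivial G] [Group.IsNilpotent G]
    (hG : IsSemiabelian G) :
    IsCyclicWreathImage G (normalGenRank G) ∧ wreathLength G = normalGenRank G := by
  obtain ⟨c, hc, hgen⟩ := hG.exists_isWreathTower_normalGenRank
  have h := hc.isCyclicWreathImage hgen
  exact ⟨h, le_antisymm (Nat.sInf_le ⟨normalGenRank_pos G, h⟩)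
    (le_csInf ⟨_, normalGenRank_pos G, h⟩ fun _ hr ↦ hr.2.normalGenRank_le)⟩
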